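/- Let $r\ge 1$, let $X=\mathbb P^{n_1}\times\cdots\times\mathbb P^{n_r}$ with Cox ring variables $V=\{x_{i,j} : 1\le i\le r,\ 0\le j\le n_i\}$ and irrelevant ideal $B_X=\bigcap_{i=1}^r\langle x_{i,0},\dots,x_{i,n_i}\rangle$, and let $\mathcal B_X$ be the simplicial complex on $V$ whose Stanley--Reisner ideal is $B_X$; that is, $F\subseteq V$ lies in $\mathcal B_X$ if and only if, for some $i$, $F$ contains none of $x_{i,0},\dots,x_{i,n_i}$. Here a simplicial complex on a finite set $V$ is a family of subsets of $V$ closed under taking subsets, $\dim F=|F|-1$, and a face $F$ of a complex $\Delta$ on $V$ is called relevant if $F\notin\mathcal B_X$. The complex $\Delta$ is relevant-connected if any two relevant faces $F,G$ of $\Delta$ are joined by a finite sequence $F=K_0,K_1,\dots,K_m=G$ of relevant faces of $\Delta$ with every $K_{t}\cap K_{t+1}$ relevant. Let $\Delta$ be a relevant-connected simplicial complex on $V$, pure of dimension $r$, all of whose facets are relevant, and suppose that the relative simplicial homology group $H_r(\Delta,\Delta\cap\mathcal B_X;\mathbb Z)$ is $0$. Then $\Delta$ is virtually shellable; that is, the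 facets of $\Delta$ can be ordered $F_1\prec\cdots\prec F_N$ (each listed once) so that there are a simplicial complex $\Delta'$ on a finite set $V'$ and a map $\psi:V'\to V$ that sends faces of $\Delta'$ to faces of $\Delta$, such that every face of $\Delta$ is the image of a face of $\Delta'$, and, writing $\psi^{-1}(F)=\{G\in\Delta' : \psi(G)=F\}$ for $F\in\Delta$: 1. $|\psi^{-1}(F_i)|=1$ for all $i$, and the single elements $G_1,\dots,G_N$ of these fibers form a shelling of $\Delta'$: $\Delta'$ is pure, $G_1,\dots,G_N$ are its facets (each listed once), and for $1\le i<N$ the complex $\langle G_{i+1}\rangle\cap\langle G_1,\dots,G_i\rangle$ is pure of dimension $\dim G_{i+1}-1$; 2. $\dim\psi(G)=\dim G$ for all $G\in\Delta'$; 3. $\{F\in\Delta : |\psi^{-1}(F)|>1\}\subseteq\mathcal B_X$. -/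

import Mathlib

namespace VirtualShelling

section Complexes

/-- A simplicial complex on a vertex set `V`: a set of finite subsets of `V` closed under taking
subsets. The empty set is allowed as a face (it has dimension `-1`), and not every element of `V`
has to be a face. The subcomplex `⟨F⟩` of all subsets of `F` is `LowerSet.Iic F`. -/
abbrev SimplicialComplex (V : Type*) := LowerSet (Finset V)

variable {V : Type*}

/-- The dimension `|F| - 1` of a simplex. -/
def dim (F : Finset V) : ℤ := (F.card : ℤ) - 1

/-- Facets are the faces that are maximal under inclusion. -/
def IsFacet (Δ : SimplicialComplex V) (F : Finset V) : Prop := Maximal (· ∈ Δ) F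

/-- All facets have the same dimension. -/
def IsPure (Δ : SimplicialComplex V) : Prop :=
  ∀ F G : Finset V, IsFacet Δ F → IsFacet Δ G → dim F = dim G

/-- `Δ` is pure of dimension `d`: it has a face (so that its dimension makes sense) and every facet
has dimension `d`. -/
def IsPureOfDim (Δ : SimplicialComplex V) (d : ℤ) : Prop :=
  (∃ F, F ∈ Δ) ∧ ∀ F, IsFacet Δ F → dim F = d

/-- `F` lists the facets of `Δ`, each exactly once: it is an ordering of the facets. -/
def IsFacetOrdering (Δ : SimplicialComplex V) {N : ℕ} (F : Fin N → Finset V) : Prop :=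
  Function.Injective F ∧ Set.range F = {G | IsFacet Δ G}

/-- The ordering `F` of the facets of the pure complex `Δ` is a shelling: every facet but the first
meets the complex generated by the earlier ones in a pure complex of codimension one. -/
def IsShelling (Δ : SimplicialComplex V) {N : ℕ} (F : Fin N → Finset V) : Prop :=
  IsPure Δ ∧ IsFacetOrdering Δ F ∧
    ∀ i : Fin N, (∃ j, j < i) →
      IsPureOfDim (LowerSet.Iic (F i) ⊓ ⨆ j : {j : Fin N // j < i}, LowerSet.Iic (F j))
        (dim (F i) - 1)

/-- The set `ψ⁻¹(F)` of the faces of `Δ'` that the vertex map `ψ` sends onto `F`. -/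
def fiber {V' : Type*} [DecidableEq V] (Δ' : SimplicialComplex V') (ψ : V' → V) (F : Finset V) :
    Set (Finset V') :=
  {G | G ∈ Δ' ∧ G.image ψ = F}

/-- The vertex map `ψ` is a simplicial map from `Δ'` to `Δ` which is surjective on faces. -/
def IsSurjectiveSimplicialMap {V' : Type*} [DecidableEq V] (Δ' : SimplicialComplex V')
    (Δ : SimplicialComplex V) (ψ : V' → V) : Prop :=
  (∀ G ∈ Δ', G.image ψ ∈ Δ) ∧ ∀ F ∈ Δ, (fiber Δ' ψ F).Nonempty

/-- The ordering `F` of the facets of `Δ` is a virtual shelling order relative to the complex `B` of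
irrelevant simplices: there are a complex `Δ'` on a finite vertex set and a surjective simplicial
map `ψ : Δ' → Δ` that preserves dimensions of faces, whose fibers with more than one element lie
over `B`, whose fibers over facets have exactly one element, and such that
`ψ⁻¹(F 0), ψ⁻¹(F 1), …` (that is, the single elements `G 0, G 1, …` of these fibers) is a shelling
of `Δ'`. -/
def IsVirtualShellingOrder [DecidableEq V] (B Δ : SimplicialComplex V) {N : ℕ} (F : Fin N → Finset V) :
    Prop :=
  IsFacetOrdering Δ F ∧
    ∃ (V' : Type) (_ : Finite V') (Δ' : SimplicialComplex V') (ψ : V' → V),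
      IsSurjectiveSimplicialMap Δ' Δ ψ ∧
      (∃ G : Fin N → Finset V', (∀ i, G i ∈ fiber Δ' ψ (F i)) ∧ IsShelling Δ' G) ∧
      (∀ G ∈ Δ', dim (G.image ψ) = dim G) ∧
      {K | K ∈ Δ ∧ 1 < (fiber Δ' ψ K).encard} ⊆ (B : Set (Finset V)) ∧
      ∀ i, (fiber Δ' ψ (F i)).encard = 1

/-- `Δ` is virtually shellable, relative to the complex `B` of irrelevant simplices. -/
def IsVirtuallyShellable [DecidableEq V] (B Δ : SimplicialComplex V) : Prop :=
  ∃ (N : ℕ) (F : Fin N → Finset V), IsVirtualShellingOrder B Δ F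

/-- A face of `Δ` is relevant if it does not lie in the complex `B` of irrelevant simplices. -/
def IsRelevantFace (B Δ : SimplicialComplex V) (F : Finset V) : Prop := F ∈ Δ ∧ F ∉ B

/-- `Δ` is relevant-connected: any two relevant faces are joined by a finite sequence of relevant
faces in which the intersection of any two consecutive ones is relevant. -/
def RelevantConnected [DecidableEq V] (B Δ : SimplicialComplex V) : Prop :=
  ∀ F G : Finset V, IsRelevantFace B Δ F → IsRelevantFace B Δ G →
    Relation.ReflTransGen
      (fun K L => IsRelevantFace B Δ K ∧ IsRelevantFace B Δ L ∧ IsRelevantFace B Δ (K ∩ L)) F G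

end Complexes

section Homology

variable {V : Type*} [LinearOrder V]

/-- The simplicial boundary operator with integer coefficients, every simplex being oriented by the
linear order on `V`: the face `F \ {v}` of `F` has the sign `(-1) ^ p`, where `p` is the position of
`v` in `F`. A vertex has the empty simplex as its boundary (augmented chains). -/
noncomputable def boundary : (Finset V →₀ ℤ) →ₗ[ℤ] (Finset V →₀ ℤ) :=
  Finsupp.linearCombination ℤ fun F =>
    ∑ v ∈ F, (-1 : ℤ) ^ (F.filter (· < v)).card • Finsupp.single (F.erase v) (1 : ℤ)

/-- The group of `k`-chains of `Δ`, free on the `k`-dimensional faces. -/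
noncomputable def chains (Δ : SimplicialComplex V) (k : ℕ) : Submodule ℤ (Finset V →₀ ℤ) :=
  Finsupp.supported ℤ ℤ {F | F ∈ Δ ∧ dim F = k}

/-- Relative `k`-cycles of the pair `(Δ, Δ ∩ B)`: the chains of `Δ` whose boundary lies in `B`. -/
noncomputable def relCycles (Δ B : SimplicialComplex V) (k : ℕ) : Submodule ℤ (Finset V →₀ ℤ) :=
  chains Δ k ⊓ (Finsupp.supported ℤ ℤ {F | F ∈ Δ ⊓ B}).comap boundary

/-- Relative `k`-boundaries of the pair `(Δ, Δ ∩ B)`: boundaries of `(k+1)`-chains of `Δ`, modulo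
`k`-chains of `Δ ∩ B`. -/
noncomputable def relBoundaries (Δ B : SimplicialComplex V) (k : ℕ) : Submodule ℤ (Finset V →₀ ℤ) :=
  (chains Δ (k + 1)).map boundary ⊔ chains (Δ ⊓ B) k

/-- The relative simplicial homology group `H_k(Δ, B; ℤ)`, that is, the homology of the pair
`(Δ, Δ ∩ B)`. As soon as the empty simplex belongs to `B`, augmented and ordinary chains give the
same relative chain complex. -/
abbrev RelHomology (Δ B : SimplicialComplex V) (k : ℕ) : Type _ :=
  relCycles Δ B k ⧸ (relBoundaries Δ B k).submoduleOf (relCycles Δ B k)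

theorem boundary_single (F : Finset V) : boundary (Finsupp.single F (1 : ℤ)) =
    ∑ v ∈ F, (-1 : ℤ) ^ (F.filter (· < v)).card • Finsupp.single (F.erase v) (1 : ℤ) := by
  simp [boundary]

theorem boundary_boundary (c : Finset V →₀ ℤ) : boundary (boundary c) = 0 := by
  suffices h : boundary ∘ₗ boundary = (0 : (Finset V →₀ ℤ) →ₗ[ℤ] (Finset V →₀ ℤ)) from
    LinearMap.congr_fun h c
  ext1 F
  ext1
  simp only [LinearMap.comp_apply, Finsupp.lsingle_apply, LinearMap.zero_apply]
  rw [boundary_single, map_sum]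
  simp only [map_smul, boundary_single, Finset.smul_sum, smul_smul]
  rw [Finset.sum_sigma']
  have key : ∀ v w : V, v ∈ F → w ∈ F → v < w →
      (-1 : ℤ) ^ (F.filter (· < v)).card * (-1) ^ ((F.erase v).filter (· < w)).card
        = -((-1 : ℤ) ^ (F.filter (· < w)).card * (-1) ^ ((F.erase w).filter (· < v)).card) := by
    intro v w hv hw hvw
    have h1 : (F.erase w).filter (· < v) = F.filter (· < v) := by
      ext u
      simp only [Finset.mem_filter, Finset.mem_erase]
      constructor
      · rintro ⟨⟨_, h⟩, h'⟩; exact ⟨h, h'⟩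
      · rintro ⟨h, h'⟩; exact ⟨⟨(h'.trans hvw).ne, h⟩, h'⟩
    have h2 : ((F.erase v).filter (· < w)).card + 1 = (F.filter (· < w)).card := by
      rw [Finset.filter_erase]
      exact Finset.card_erase_add_one (by simp [hv, hvw])
    rw [h1, ← h2, pow_succ]
    ring
  refine Finset.sum_involution (fun p _ => ⟨p.2, p.1⟩) ?_ ?_ ?_ ?_
  · rintro ⟨v, w⟩ hp
    simp only [Finset.mem_sigma, Finset.mem_erase] at hp
    obtain ⟨hv, hne, hw⟩ := hp
    simp only
    rw [Finset.erase_right_comm (a := w) (b := v), ← add_smul]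
    rcases lt_or_gt_of_ne hne with h | h
    · rw [key w v hw hv h]; simp
    · rw [key v w hv hw h]; simp
  · rintro ⟨v, w⟩ hp _ heq
    simp only [Finset.mem_sigma, Finset.mem_erase] at hp
    simp only [Sigma.mk.injEq, heq_eq_eq] at heq
    exact hp.2.1 heq.1
  · rintro ⟨v, w⟩ hp
    simp only [Finset.mem_sigma, Finset.mem_erase] at hp ⊢
    exact ⟨hp.2.2, hp.2.1.symm, hp.1⟩
  · rintro ⟨v, w⟩ _
    rfl

theorem boundary_mem_chains (Δ : SimplicialComplex V) (k : ℕ) {c : Finset V →₀ ℤ}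
    (hc : c ∈ chains Δ (k + 1)) : boundary c ∈ chains Δ k := by
  rw [boundary, Finsupp.linearCombination_apply, Finsupp.sum]
  refine Submodule.sum_mem _ fun F hF => Submodule.smul_mem _ _ (Submodule.sum_mem _ fun v hv =>
    Submodule.smul_mem _ _ (Finsupp.single_mem_supported ℤ _ ?_))
  obtain ⟨h1, h2⟩ := hc hF
  refine ⟨Δ.lower (Finset.erase_subset v F) h1, ?_⟩
  have := Finset.card_erase_add_one hv
  simp only [dim] at h2 ⊢
  push_cast at h2
  omega

theorem boundary_mem_supported (Δ : SimplicialComplex V) {c : Finset V →₀ ℤ}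
    (hc : c ∈ Finsupp.supported ℤ ℤ {F | F ∈ Δ}) :
    boundary c ∈ Finsupp.supported ℤ ℤ {F | F ∈ Δ} := by
  rw [boundary, Finsupp.linearCombination_apply, Finsupp.sum]
  exact Submodule.sum_mem _ fun F hF => Submodule.smul_mem _ _ (Submodule.sum_mem _ fun v hv =>
    Submodule.smul_mem _ _ (Finsupp.single_mem_supported ℤ _
      (Δ.lower (Finset.erase_subset v F) (hc hF))))

theorem relBoundaries_le_relCycles (Δ B : SimplicialComplex V) (k : ℕ) :
    relBoundaries Δ B k ≤ relCycles Δ B k := by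
  refine sup_le ?_ fun c hc => ⟨?_, ?_⟩
  · rintro _ ⟨c, hc, rfl⟩
    refine ⟨boundary_mem_chains Δ k hc, ?_⟩
    simp only [SetLike.mem_coe, Submodule.mem_comap, boundary_boundary]
    exact Submodule.zero_mem _
  · have hsub : {F | F ∈ Δ ⊓ B ∧ dim F = k} ⊆ {F | F ∈ Δ ∧ dim F = k} :=
      fun F hF => ⟨hF.1.1, hF.2⟩
    exact Finsupp.supported_mono hsub hc
  · have hsub : {F | F ∈ Δ ⊓ B ∧ dim F = k} ⊆ {F | F ∈ Δ ⊓ B} := fun F hF => hF.1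
    exact boundary_mem_supported (Δ ⊓ B) (Finsupp.supported_mono hsub hc)

end Homology

section ProductsOfProjectiveSpaces

variable {r : ℕ} (n : Fin r → ℕ)

/-- The variables `x_{i,j}`, `0 ≤ j ≤ n i`, of the Cox ring of
`ℙ^{n 0} × ⋯ × ℙ^{n (r-1)}`, ordered lexicographically. -/
abbrev CoxVar := Σₗ i : Fin r, Fin (n i + 1)

/-- The irrelevant complex of the product of projective spaces: a simplex is irrelevant when it
contains no variable of one of the factors. -/
def irrelevantComplex : SimplicialComplex (CoxVar n) where
  carrier := {F | ∃ i : Fin r, ∀ v ∈ F, (ofLex v).1 ≠ i}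
  lower' := fun _ _ h ⟨i, hi⟩ => ⟨i, fun v hv => hi v (h hv)⟩

/-- The irrelevant ideal `⋂ i, ⟨x_{i,0}, …, x_{i,n i}⟩` of the Cox ring. -/
noncomputable def irrelevantIdeal (K : Type*) [Field K] : Ideal (MvPolynomial (CoxVar n) K) :=
  ⨅ i : Fin r, Ideal.span (MvPolynomial.X '' {v | (ofLex v).1 = i})

/-- The Stanley-Reisner ideal of a complex, generated by the square-free monomials of its
nonfaces. -/
noncomputable def stanleyReisnerIdeal {V : Type*} (K : Type*) [Field K] (Δ : SimplicialComplex V) :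
    Ideal (MvPolynomial V K) :=
  Ideal.span ((fun F : Finset V => ∏ v ∈ F, MvPolynomial.X v) '' {F | F ∉ Δ})

/-- The irrelevant complex is the complex whose Stanley-Reisner ideal is the irrelevant ideal. -/
theorem stanleyReisnerIdeal_irrelevantComplex (K : Type*) [Field K] :
    stanleyReisnerIdeal K (irrelevantComplex n) = irrelevantIdeal n K := by
  apply le_antisymm
  · rw [stanleyReisnerIdeal, Ideal.span_le]
    rintro _ ⟨F, hF, rfl⟩
    simp only [irrelevantIdeal, SetLike.mem_coe, Ideal.mem_iInf]
    intro i
    have : ∃ v ∈ F, (ofLex v).1 = i := by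
      by_contra! h
      exact hF ⟨i, h⟩
    obtain ⟨v, hv, hi⟩ := this
    exact Ideal.mem_of_dvd _ (Finset.dvd_prod_of_mem _ hv)
      (Ideal.subset_span (Set.mem_image_of_mem _ hi))
  · intro p hp
    rw [p.as_sum]
    refine Ideal.sum_mem _ fun m hm => ?_
    have hF : m.support ∉ irrelevantComplex n := by
      rintro ⟨i, hi⟩
      have h := (Ideal.mem_iInf.1 hp) i
      rw [MvPolynomial.mem_ideal_span_X_image] at h
      obtain ⟨v, hv, hne⟩ := h m hm
      exact hi v (Finsupp.mem_support_iff.2 hne) hv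
    refine Ideal.mem_of_dvd _ ?_ (Ideal.subset_span (Set.mem_image_of_mem _ hF))
    rw [MvPolynomial.monomial_eq, Finsupp.prod]
    exact Dvd.dvd.mul_left (Finset.prod_dvd_prod_of_dvd _ _ fun v hv =>
      dvd_pow_self _ (Finsupp.mem_support_iff.1 hv)) _

end ProductsOfProjectiveSpaces

end VirtualShelling

namespace VirtualShelling

/-! ### Enumerations of connected finite sets -/

section Orderings

/-! A relevant simplex meets each of the `r` factors, so it has at least `r` vertices. A facet has
`r + 1`, so exactly two of its vertices share a factor, and its relevant ridges are the two obtained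
by deleting one of these. Consider the graph whose vertices are the relevant ridges and whose edges
are the facets. Modulo irrelevant simplices the boundary of a facet is, up to sign, the difference
of its two ends (`exists_boundary_smul_single`), and there are no relative boundaries in degree `r`.
Hence the relative homology group is the cycle space of this graph; its vanishing makes the graph a
forest, and relevant-connectedness makes it a tree.

Enumerate the edges so that each one after the first touches an earlier one
(`exists_connected_enumeration`). In a tree the new edge meets the earlier ones at only one end
(`inter_eq_inter_of_connected`), so all relevant intersections with earlier facets equal a single
ridge. Call any earlier facet containing that ridge the parent. Take disjoint copies of the facets
and glue each to its parent along this ridge only. The glued complex is shelled by construction, and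
a relevant face is never duplicated, since it passes from any facet to the parent whenever it also
lies in an earlier one (`isVirtualShellingOrder_of_parent`). -/

/-- A finite set that is connected under a relation can be enumerated so that every element but the
first is related to an earlier one. -/
theorem exists_connected_enumeration {α : Type*} [DecidableEq α] (T : Finset α)
    (rel : α → α → Prop) (hT : T.Nonempty)
    (hconn : ∀ x ∈ T, ∀ y ∈ T, Relation.ReflTransGen (fun a b => b ∈ T ∧ rel a b) x y)
    (k : ℕ) (hk : k ≤ T.card) :
    ∃ f : ℕ → α, Set.InjOn f (Set.Iio k) ∧ (∀ i < k, f i ∈ T) ∧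
      ∀ i < k, 0 < i → ∃ j < i, rel (f j) (f i) := by
  induction k with
  | zero => exact ⟨fun _ => hT.choose, by simp [Set.InjOn], by simp, by simp⟩
  | succ k ih =>
    obtain ⟨f, hinj, hmem, hrel⟩ := ih (by omega)
    have hcard : ((Finset.range k).image f).card < T.card :=
      lt_of_le_of_lt Finset.card_image_le (by simpa using hk)
    obtain ⟨y, hyT, hy⟩ := Finset.exists_mem_notMem_of_card_lt_card hcard
    obtain ⟨x, hxT, hx, hxr⟩ : ∃ x ∈ T, x ∉ (Finset.range k).image f ∧
        (0 < k → ∃ j < k, rel (f j) x) := by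
      rcases Nat.eq_zero_or_pos k with rfl | hpos
      · exact ⟨y, hyT, hy, by simp⟩
      -- If no new element were related to an enumerated one, every path from `f 0` would stay among
      -- the enumerated elements and miss `y`.
      · by_contra! hno
        have hall : ∀ z, Relation.ReflTransGen (fun a b => b ∈ T ∧ rel a b) (f 0) z →
            z ∈ (Finset.range k).image f := by
          intro z hz
          induction hz with
          | refl => exact Finset.mem_image_of_mem _ (by simpa using hpos)
          | @tail b c _ hbc ihb =>
            by_contra hc
            obtain ⟨j, hj, rfl⟩ := Finset.mem_image.1 ihb
            exact (hno c hbc.1 hc).2 j (by simpa using hj) hbc.2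
        exact hy (hall y (hconn _ (hmem 0 hpos) _ hyT))
    have hne : ∀ i < k, f i ≠ x := fun i hi h =>
      hx (Finset.mem_image.2 ⟨i, by simpa using hi, h⟩)
    have hup : ∀ i < k, Function.update f k x i = f i := fun i hi =>
      Function.update_of_ne hi.ne _ _
    have hupk : Function.update f k x k = x := Function.update_self _ _ _
    refine ⟨Function.update f k x, ?_, ?_, ?_⟩
    · intro i hi j hj hij
      rcases Nat.lt_succ_iff_lt_or_eq.1 hi with hi | rfl <;>
        rcases Nat.lt_succ_iff_lt_or_eq.1 hj with hj | rfl
      · rw [hup i hi, hup j hj] at hij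
        exact hinj hi hj hij
      · rw [hup i hi, hupk] at hij
        exact absurd hij (hne i hi)
      · rw [hup j hj, hupk] at hij
        exact absurd hij.symm (hne j hj)
      · rfl
    · intro i hi
      rcases Nat.lt_succ_iff_lt_or_eq.1 hi with hi | rfl
      · rw [hup i hi]; exact hmem i hi
      · rw [hupk]; exact hxT
    · intro i hi hpos
      rcases Nat.lt_succ_iff_lt_or_eq.1 hi with hi | rfl
      · obtain ⟨j, hj, h⟩ := hrel i hi hpos
        exact ⟨j, hj, by rwa [hup i hi, hup j (hj.trans hi)]⟩
      · obtain ⟨j, hj, h⟩ := hxr hpos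
        exact ⟨j, hj, by rwa [hupk, hup j hj]⟩

end Orderings

/-! ### Gluing simplices along a parent map -/

section Gluing

variable {V : Type} [DecidableEq V] {N : ℕ}

/-- Climbing from the index `i` along the parent map `p` as long as the vertex `v` lies in the
parent simplex: the index of the simplex in which the copy of `v` used by `F i` is introduced. -/
def originIndex (F : Fin N → Finset V) (p : Fin N → Fin N) (v : V) (i : Fin N) : Fin N :=
  if p i < i ∧ v ∈ F (p i) then originIndex F p v (p i) else i
termination_by i.val
decreasing_by omega

theorem originIndex_of_mem {F : Fin N → Finset V} {p : Fin N → Fin N} {v : V} {i : Fin N}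
    (hp : p i < i) (hv : v ∈ F (p i)) : originIndex F p v i = originIndex F p v (p i) := by
  rw [originIndex, if_pos ⟨hp, hv⟩]

theorem originIndex_of_notMem {F : Fin N → Finset V} {p : Fin N → Fin N} {v : V} {i : Fin N}
    (hv : v ∉ F (p i)) : originIndex F p v i = i := by
  rw [originIndex, if_neg fun h => hv h.2]

theorem originIndex_le (F : Fin N → Finset V) (p : Fin N → Fin N) (v : V) (i : Fin N) :
    originIndex F p v i ≤ i := by
  induction i using WellFoundedLT.induction with
  | ind i ih =>
    rw [originIndex]
    split_ifs with h
    · exact (ih _ h.1).trans h.1.le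
    · exact le_rfl

/-- The lift of a subset `K` of `F i` to the complex obtained by gluing every `F i` to `F (p i)`
along their intersection. -/
def lift (F : Fin N → Finset V) (p : Fin N → Fin N) (i : Fin N) (K : Finset V) :
    Finset (Fin N × V) :=
  K.image fun v => (originIndex F p v i, v)

/-- The complex obtained by gluing every simplex `F i` to `F (p i)` along their intersection. -/
def gluedComplex (F : Fin N → Finset V) (p : Fin N → Fin N) : SimplicialComplex (Fin N × V) :=
  ⨆ i, LowerSet.Iic (lift F p i (F i))

variable {F : Fin N → Finset V} {p : Fin N → Fin N}

theorem image_snd_lift (i : Fin N) (K : Finset V) : (lift F p i K).image Prod.snd = K := by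
  simp [lift, Finset.image_image, Function.comp_def]

theorem card_lift (i : Fin N) (K : Finset V) : (lift F p i K).card = K.card :=
  Finset.card_image_of_injective _ fun _ _ h => (Prod.ext_iff.1 h).2

theorem lift_mono {i : Fin N} {K L : Finset V} (h : K ⊆ L) : lift F p i K ⊆ lift F p i L :=
  Finset.image_subset_image h

theorem mem_gluedComplex {G : Finset (Fin N × V)} :
    G ∈ gluedComplex F p ↔ ∃ i, G ⊆ lift F p i (F i) := by
  simp [gluedComplex]

/-- Inside one lifted simplex the first coordinate is a function of the second. Comparing faces of
the glued complex thus reduces to comparing lifts of the same set from different indices. -/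
theorem eq_lift_of_subset {i : Fin N} {K : Finset V} {G : Finset (Fin N × V)}
    (h : G ⊆ lift F p i K) : G = lift F p i (G.image Prod.snd) := by
  have hG : ∀ x ∈ G, x = (originIndex F p x.2 i, x.2) := by
    intro x hx
    obtain ⟨v, _, rfl⟩ := Finset.mem_image.1 (h hx)
    rfl
  rw [lift, Finset.image_image]
  conv_lhs => rw [← Finset.image_id (s := G)]
  exact Finset.image_congr fun x hx => hG x hx

theorem image_snd_subset {i : Fin N} {K : Finset V} {G : Finset (Fin N × V)}
    (h : G ⊆ lift F p i K) : G.image Prod.snd ⊆ K :=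
  (Finset.image_subset_image h).trans (image_snd_lift i K).subset

theorem lift_parent {i : Fin N} {K : Finset V} (hp : p i < i) (hK : K ⊆ F (p i)) :
    lift F p i K = lift F p (p i) K :=
  Finset.image_congr fun v hv => by
    simp only [originIndex_of_mem hp (hK hv)]

/-- A simplex that can only meet earlier members of the sequence `F` inside the parent has a unique
lift. -/
theorem lift_eq_lift {K : Finset V}
    (hK : ∀ i j, j < i → K ⊆ F i → K ⊆ F j → p i < i ∧ K ⊆ F (p i)) (i j : Fin N)
    (hi : K ⊆ F i) (hj : K ⊆ F j) : lift F p i K = lift F p j K := by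
  -- The larger of the two indices is moved to its parent, which still contains `K` and has the same
  -- lift of `K`.
  induction hm : i.val + j.val using Nat.strong_induction_on generalizing i j with
  | _ m ih =>
    rcases lt_trichotomy i j with hij | rfl | hij
    · obtain ⟨hp, hKp⟩ := hK j i hij hj hi
      rw [lift_parent hp hKp]
      exact ih _ (by omega) i (p j) hi hKp rfl
    · rfl
    · obtain ⟨hp, hKp⟩ := hK i j hij hi hj
      rw [lift_parent hp hKp]
      exact ih _ (by omega) (p i) j hKp hj rfl

theorem isFacet_Iic_iff {W : Type*} (G H : Finset W) : IsFacet (LowerSet.Iic G) H ↔ H = G := by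
  constructor
  · rintro ⟨h1, h2⟩
    exact le_antisymm h1 (h2 (LowerSet.mem_Iic_iff.2 le_rfl) h1)
  · rintro rfl
    exact ⟨LowerSet.mem_Iic_iff.2 le_rfl, fun _ h _ => h⟩

theorem isPureOfDim_Iic {W : Type*} (G : Finset W) : IsPureOfDim (LowerSet.Iic G) (dim G) :=
  ⟨⟨G, LowerSet.mem_Iic_iff.2 le_rfl⟩, fun _ h => by rw [(isFacet_Iic_iff _ _).1 h]⟩

/-- All generators have the same cardinality, so none is properly contained in another. -/
theorem isFacet_gluedComplex_iff {d : ℕ} (hcard : ∀ i, (F i).card = d) (G : Finset (Fin N × V)) :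
    IsFacet (gluedComplex F p) G ↔ ∃ i, lift F p i (F i) = G := by
  constructor
  · rintro ⟨h1, h2⟩
    obtain ⟨i, hi⟩ := mem_gluedComplex.1 h1
    exact ⟨i, le_antisymm (h2 (mem_gluedComplex.2 ⟨i, subset_rfl⟩) hi) hi⟩
  · rintro ⟨i, rfl⟩
    refine ⟨mem_gluedComplex.2 ⟨i, subset_rfl⟩, fun H hH hle => ?_⟩
    obtain ⟨j, hj⟩ := mem_gluedComplex.1 hH
    refine (Finset.eq_of_subset_of_card_le hle ?_).ge
    refine (Finset.card_le_card hj).trans ?_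
    rw [card_lift, card_lift, hcard, hcard]

/-- Every simplex of the glued complex meets the earlier ones exactly in its intersection with its
parent. -/
theorem Iic_lift_inf_iSup {i : Fin N} (hp : p i < i) :
    LowerSet.Iic (lift F p i (F i)) ⊓
        ⨆ j : {j : Fin N // j < i}, LowerSet.Iic (lift F p j (F j)) =
      LowerSet.Iic (lift F p i (F i ∩ F (p i))) := by
  ext G
  simp only [LowerSet.coe_inf, LowerSet.coe_iSup, Set.mem_inter_iff, Set.mem_iUnion,
    LowerSet.coe_Iic, Set.mem_Iic]
  constructor
  · rintro ⟨hG, ⟨j, hji⟩, hGj⟩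
    intro x hx
    obtain ⟨v, hv, rfl⟩ := Finset.mem_image.1 (hG hx)
    refine Finset.mem_image.2 ⟨v, Finset.mem_inter.2 ⟨hv, ?_⟩, rfl⟩
    -- A vertex outside the parent is a new copy, labelled `i`, while the copies used by `F j` carry
    -- labels at most `j < i`.
    by_contra hvp
    obtain ⟨w, _, hw⟩ := Finset.mem_image.1 (hGj hx)
    have h1 := (Prod.ext_iff.1 hw).1
    simp only [originIndex_of_notMem hvp] at h1
    have h2 := originIndex_le F p w j
    rw [h1] at h2
    exact absurd hji (not_lt.2 h2)
  · intro hG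
    refine ⟨hG.trans (lift_mono Finset.inter_subset_left), ⟨p i, hp⟩, ?_⟩
    rw [lift_parent hp Finset.inter_subset_right] at hG
    exact hG.trans (lift_mono Finset.inter_subset_right)

/-- An ordering of the facets in which every facet but the first has a parent, meeting it in
codimension one and containing its relevant intersections with earlier facets, is a virtual shelling
order. -/
theorem isVirtualShellingOrder_of_parent [Finite V] {B Δ : SimplicialComplex V} {d : ℕ}
    (hF : IsFacetOrdering Δ F) (hcard : ∀ i, (F i).card = d + 1)
    (hcover : ∀ K ∈ Δ, ∃ i, K ⊆ F i)
    (hp : ∀ i, (∃ j, j < i) → p i < i ∧ (F i ∩ F (p i)).card = d)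
    (hB : ∀ K ∉ B, ∀ i j, j < i → K ⊆ F i → K ⊆ F j → K ⊆ F (p i)) :
    IsVirtualShellingOrder B Δ F := by
  have hmem : ∀ i, F i ∈ Δ := fun i =>
    (hF.2.subset (Set.mem_range_self i)).1
  have hlift : ∀ i, lift F p i (F i) ∈ gluedComplex F p := fun i =>
    mem_gluedComplex.2 ⟨i, subset_rfl⟩
  refine ⟨hF, Fin N × V, inferInstance, gluedComplex F p, Prod.snd, ⟨?_, ?_⟩,
    ⟨fun i => lift F p i (F i), fun i => ⟨hlift i, image_snd_lift i _⟩, ?_, ⟨?_, ?_⟩, ?_⟩,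
    ?_, ?_, ?_⟩
  · intro G hG
    obtain ⟨i, hi⟩ := mem_gluedComplex.1 hG
    exact Δ.lower (image_snd_subset hi) (hmem i)
  · intro K hK
    obtain ⟨i, hi⟩ := hcover K hK
    exact ⟨lift F p i K, mem_gluedComplex.2 ⟨i, lift_mono hi⟩, image_snd_lift i K⟩
  · intro G H hG hH
    obtain ⟨i, rfl⟩ := (isFacet_gluedComplex_iff hcard G).1 hG
    obtain ⟨j, rfl⟩ := (isFacet_gluedComplex_iff hcard H).1 hH
    simp [dim, card_lift, hcard]
  · intro i j hij
    apply hF.1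
    rw [← image_snd_lift (F := F) (p := p) i (F i), ← image_snd_lift (F := F) (p := p) j (F j)]
    exact congrArg _ hij
  · ext G
    exact (isFacet_gluedComplex_iff hcard G).symm
  · intro i hi
    obtain ⟨h1, h2⟩ := hp i hi
    simp only
    rw [Iic_lift_inf_iSup h1]
    convert isPureOfDim_Iic _ using 1
    simp [dim, card_lift, hcard, h2]
  · intro G hG
    obtain ⟨i, hi⟩ := mem_gluedComplex.1 hG
    conv_rhs => rw [eq_lift_of_subset hi]
    simp [dim, card_lift]
  · rintro K ⟨_, hK⟩
    by_contra hKB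
    obtain ⟨G, H, hG, hH, hne⟩ := Set.one_lt_encard_iff.1 hK
    obtain ⟨i, hi⟩ := mem_gluedComplex.1 hG.1
    obtain ⟨j, hj⟩ := mem_gluedComplex.1 hH.1
    have hKi := image_snd_subset hi
    have hKj := image_snd_subset hj
    refine hne ?_
    rw [eq_lift_of_subset hi, eq_lift_of_subset hj]
    rw [hG.2] at hKi ⊢
    rw [hH.2] at hKj ⊢
    -- Two preimages of a relevant `K` are its lifts from `i` and from `j`, which agree.
    exact lift_eq_lift (fun a b hba ha hb => ⟨(hp a ⟨b, hba⟩).1, hB K hKB a b hba ha hb⟩) i j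
      hKi hKj
  · intro i
    refine Set.encard_eq_one.2 ⟨lift F p i (F i), Set.eq_singleton_iff_unique_mem.2
      ⟨⟨hlift i, image_snd_lift i _⟩, ?_⟩⟩
    rintro G ⟨hG, hGF⟩
    obtain ⟨j, hj⟩ := mem_gluedComplex.1 hG
    have hsub := image_snd_subset hj
    rw [hGF] at hsub
    have hij : i = j := hF.1 (Finset.eq_of_subset_of_card_le hsub (by rw [hcard, hcard]))
    subst hij
    rw [eq_lift_of_subset hj, hGF]

end Gluing

/-! ### Relevant ridges of a facet and its boundary modulo irrelevant simplices -/

section RelevantRidges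

variable {r : ℕ} {n : Fin r → ℕ} {F K : Finset (CoxVar n)}

theorem notMem_irrelevantComplex_iff :
    F ∉ irrelevantComplex n ↔ ∀ i, ∃ v ∈ F, (ofLex v).1 = i := by
  change ¬(∃ i : Fin r, ∀ v ∈ F, (ofLex v).1 ≠ i) ↔ _
  push Not
  rfl

theorem notMem_irrelevantComplex_of_subset (h : K ⊆ F) (hK : K ∉ irrelevantComplex n) :
    F ∉ irrelevantComplex n := fun hF => hK ((irrelevantComplex n).lower h hF)

theorem image_factor_eq_univ (hF : F ∉ irrelevantComplex n) :
    F.image (fun v => (ofLex v).1) = Finset.univ := by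
  ext i
  simpa using notMem_irrelevantComplex_iff.1 hF i

theorem le_card_of_notMem_irrelevantComplex (hF : F ∉ irrelevantComplex n) : r ≤ F.card := by
  simpa [image_factor_eq_univ hF] using Finset.card_image_le (s := F) (f := fun v => (ofLex v).1)

/-- A relevant simplex with `r` vertices has only one vertex in every factor. -/
theorem factor_injOn (hF : F ∉ irrelevantComplex n) (hcard : F.card = r) :
    Set.InjOn (fun v : CoxVar n => (ofLex v).1) F :=
  Finset.card_image_iff.1 (by rw [image_factor_eq_univ hF, Finset.card_univ, Fintype.card_fin, hcard])

/-- A relevant simplex with `r + 1` vertices has two consecutive vertices in the same factor, and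
its relevant facets are those opposite to these two vertices. -/
theorem exists_consecutive (hF : F ∉ irrelevantComplex n) (hcard : F.card = r + 1) :
    ∃ a ∈ F, ∃ b ∈ F, a < b ∧ F.filter (· < b) = insert a (F.filter (· < a)) ∧
      ∀ v ∈ F, F.erase v ∉ irrelevantComplex n → v = a ∨ v = b := by
  obtain ⟨a, ha, b, hb, hab, hfac⟩ : ∃ a ∈ F, ∃ b ∈ F, a < b ∧ (ofLex a).1 = (ofLex b).1 := by
    -- Pigeonhole: `r + 1` vertices in `r` factors.
    obtain ⟨a, ha, b, hb, hne, h⟩ := Finset.exists_ne_map_eq_of_card_lt_of_maps_to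
      (s := F) (t := Finset.univ) (f := fun v => (ofLex v).1) (by simp [hcard]) (by simp)
    rcases lt_or_gt_of_ne hne with h1 | h1
    · exact ⟨a, ha, b, hb, h1, h⟩
    · exact ⟨b, hb, a, ha, h1, h.symm⟩
  have herase : ∀ v ∈ F, (F.erase v).card = r := fun v hv => by
    rw [Finset.card_erase_of_mem hv, hcard, Nat.add_sub_cancel]
  refine ⟨a, ha, b, hb, hab, ?_, ?_⟩
  · ext v
    simp only [Finset.mem_filter, Finset.mem_insert]
    constructor
    · rintro ⟨hv, hvb⟩
      rcases lt_trichotomy v a with h | h | h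
      · exact Or.inr ⟨hv, h⟩
      · exact Or.inl h
      -- In the lexicographic order a vertex strictly between `a` and `b` lies in their common
      -- factor. Deleting `a` would then leave a relevant simplex with `r` vertices, two of them in
      -- one factor.
      · have h1 : (ofLex a).1 ≤ (ofLex v).1 := Sigma.Lex.le_def.1 h.le |>.elim le_of_lt
          fun ⟨h, _⟩ => h.le
        have h2 : (ofLex v).1 ≤ (ofLex b).1 := Sigma.Lex.le_def.1 hvb.le |>.elim le_of_lt
          fun ⟨h, _⟩ => h.le
        have h3 : (ofLex v).1 = (ofLex b).1 := le_antisymm h2 (hfac ▸ h1)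
        have hrel : F.erase a ∉ irrelevantComplex n := by
          rw [notMem_irrelevantComplex_iff] at hF ⊢
          intro i
          obtain ⟨w, hw, rfl⟩ := hF i
          by_cases hwa : w = a
          · exact ⟨b, Finset.mem_erase.2 ⟨hab.ne', hb⟩, by rw [hwa, hfac]⟩
          · exact ⟨w, Finset.mem_erase.2 ⟨hwa, hw⟩, rfl⟩
        exact absurd (factor_injOn hrel (herase a ha)
          (Finset.mem_coe.2 (Finset.mem_erase.2 ⟨h.ne', hv⟩))
          (Finset.mem_coe.2 (Finset.mem_erase.2 ⟨hab.ne', hb⟩)) h3) hvb.ne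
    · rintro (rfl | ⟨hv, h⟩)
      · exact ⟨ha, hab⟩
      · exact ⟨hv, h.trans hab⟩
  · intro v hv hrel
    -- Deleting any third vertex keeps both `a` and `b`, which a relevant simplex with `r` vertices
    -- cannot contain.
    by_contra! hne
    exact hab.ne (factor_injOn hrel (herase v hv)
      (Finset.mem_coe.2 (Finset.mem_erase.2 ⟨hne.1.symm, ha⟩))
      (Finset.mem_coe.2 (Finset.mem_erase.2 ⟨hne.2.symm, hb⟩)) hfac)

/-- The chains supported on irrelevant simplices. -/
noncomputable abbrev irrelevantChains (n : Fin r → ℕ) : Submodule ℤ (Finset (CoxVar n) →₀ ℤ) :=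
  Finsupp.supported ℤ ℤ {F | F ∈ irrelevantComplex n}

/-- Modulo irrelevant simplices, the boundary of a relevant simplex with `r + 1` vertices is, up to
sign, the difference of any two distinct relevant facets of it. -/
theorem exists_boundary_smul_single (hF : F ∉ irrelevantComplex n) (hcard : F.card = r + 1)
    {R R' : Finset (CoxVar n)} (hR : R ∉ irrelevantComplex n) (hR' : R' ∉ irrelevantComplex n)
    (hRF : R ⊆ F) (hRF' : R' ⊆ F) (hRc : R.card = r) (hRc' : R'.card = r) :
    ∃ m : ℤ, (R ≠ R' → m ≠ 0) ∧
      boundary (Finsupp.single F m) - (Finsupp.single R 1 - Finsupp.single R' 1) ∈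
        irrelevantChains n := by
  obtain ⟨a, ha, b, hb, hab, hpos, hall⟩ := exists_consecutive hF hcard
  have hform : ∀ S : Finset (CoxVar n), S ∉ irrelevantComplex n → S ⊆ F → S.card = r →
      S = F.erase a ∨ S = F.erase b := by
    intro S hS hSF hSc
    have hss : S ⊂ F := Finset.ssubset_iff_subset_ne.2 ⟨hSF, by rintro rfl; omega⟩
    obtain ⟨v, hv, hSv⟩ := Finset.ssubset_iff_exists_subset_erase.1 hss
    obtain rfl : S = F.erase v := Finset.eq_of_subset_of_card_le hSv
      (by rw [Finset.card_erase_of_mem hv, hcard, hSc, Nat.add_sub_cancel])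
    exact (hall v hv hS).imp (by rintro rfl; rfl) (by rintro rfl; rfl)
  obtain ⟨s, hs⟩ : ∃ s : ℤ, s = (-1) ^ (F.filter (· < a)).card := ⟨_, rfl⟩
  have hss : s * s = 1 := by rw [hs, ← mul_pow]; norm_num
  have hsne : s ≠ 0 := by rw [hs]; positivity
  -- Consecutive positions give opposite signs; this is why the boundary is a difference of the two
  -- ridges rather than a sum.
  have hsb : (-1 : ℤ) ^ (F.filter (· < b)).card = -s := by
    rw [hpos, Finset.card_insert_of_notMem (by simp), pow_succ, hs]; ring
  have hbd : boundary (Finsupp.single F (1 : ℤ)) -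
      s • (Finsupp.single (F.erase a) 1 - Finsupp.single (F.erase b) 1) ∈ irrelevantChains n := by
    rw [boundary_single, ← Finset.add_sum_erase F _ ha,
      ← Finset.add_sum_erase (F.erase a) _ (Finset.mem_erase.2 ⟨hab.ne', hb⟩), hsb, ← hs]
    have hmem : ∑ v ∈ (F.erase a).erase b, (-1 : ℤ) ^ (F.filter (· < v)).card •
        Finsupp.single (F.erase v) (1 : ℤ) ∈ irrelevantChains n := by
      refine Submodule.sum_mem _ fun v hv => Submodule.smul_mem _ _
        (Finsupp.single_mem_supported ℤ _ ?_)
      simp only [Finset.mem_erase] at hv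
      by_contra hirr
      rcases hall v hv.2.2 hirr with h | h
      · exact hv.2.1 h
      · exact hv.1 h
    have halg : ∀ x y z : Finset (CoxVar n) →₀ ℤ, s • x + (-s • y + z) - s • (x - y) = z := by
      intro x y z
      module
    convert hmem using 1
    exact halg _ _ _
  have key : ∀ t : ℤ, boundary (Finsupp.single F t) -
      (t * s) • (Finsupp.single (F.erase a) 1 - Finsupp.single (F.erase b) 1) ∈
        irrelevantChains n := by
    intro t
    have h := Submodule.smul_mem (irrelevantChains n) t hbd
    rwa [smul_sub, ← map_smul, Finsupp.smul_single_one, smul_smul] at h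
  -- The coefficient is `0` when the ridges coincide, and otherwise `s` or `-s` according to their
  -- order.
  rcases hform R hR hRF hRc with rfl | rfl <;> rcases hform R' hR' hRF' hRc' with rfl | rfl
  · exact ⟨0, fun h => absurd rfl h, by simp⟩
  · refine ⟨s, fun _ => hsne, ?_⟩
    simpa only [hss, one_smul] using key s
  · refine ⟨-s, fun _ => neg_ne_zero.2 hsne, ?_⟩
    have h := key (-s)
    rwa [neg_mul, hss, neg_smul, one_smul, neg_sub] at h
  · exact ⟨0, fun h => absurd rfl h, by simp⟩

end RelevantRidges

/-! ### Vanishing homology and the tree of relevant ridges -/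

section Trees

variable {r : ℕ} {n : Fin r → ℕ} {Δ : SimplicialComplex (CoxVar n)}

theorem card_eq_of_isFacet (hpure : IsPureOfDim Δ (r : ℤ)) {F : Finset (CoxVar n)}
    (hF : IsFacet Δ F) : F.card = r + 1 := by
  have h := hpure.2 F hF
  simp only [dim] at h
  omega

theorem exists_isFacet_superset {V : Type*} [Finite V] {Δ : SimplicialComplex V} {K : Finset V}
    (hK : K ∈ Δ) : ∃ F, IsFacet Δ F ∧ K ⊆ F := by
  obtain ⟨F, hKF, hF⟩ := (Set.toFinite {F | F ∈ Δ}).exists_le_maximal hK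
  exact ⟨F, hF, hKF⟩

/-- If the intersection of two distinct facets is relevant, it has exactly `r` vertices. -/
theorem card_inter_eq (hpure : IsPureOfDim Δ (r : ℤ)) {F G : Finset (CoxVar n)}
    (hF : IsFacet Δ F) (hG : IsFacet Δ G) (hne : F ≠ G) (hI : F ∩ G ∉ irrelevantComplex n) :
    (F ∩ G).card = r := by
  have hFc := card_eq_of_isFacet hpure hF
  have hGc := card_eq_of_isFacet hpure hG
  have h1 := le_card_of_notMem_irrelevantComplex hI
  have h2 : (F ∩ G).card ≠ r + 1 := by
    intro h
    have e1 : F ∩ G = F := Finset.eq_of_subset_of_card_le Finset.inter_subset_left (by omega)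
    have e2 : F ∩ G = G := Finset.eq_of_subset_of_card_le Finset.inter_subset_right (by omega)
    exact hne (e1.symm.trans e2)
  have h3 := Finset.card_le_card (Finset.inter_subset_left : F ∩ G ⊆ F)
  omega

/-- There are no nonzero relative cycles in top dimension if the top relative homology vanishes. -/
theorem eq_zero_of_mem_relCycles (hpure : IsPureOfDim Δ (r : ℤ))
    (hrel : ∀ F, IsFacet Δ F → IsRelevantFace (irrelevantComplex n) Δ F)
    (hH : Subsingleton (RelHomology Δ (irrelevantComplex n) r))
    {c : Finset (CoxVar n) →₀ ℤ} (hc : c ∈ relCycles Δ (irrelevantComplex n) r) : c = 0 := by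
  have hle : ∀ G ∈ Δ, ∃ F, IsFacet Δ F ∧ G ⊆ F ∧ F.card = r + 1 := fun G hG => by
    obtain ⟨F, hF, hGF⟩ := exists_isFacet_superset hG
    exact ⟨F, hF, hGF, card_eq_of_isFacet hpure hF⟩
  -- There are no faces of dimension `r + 1`, and every face of dimension `r` is a facet, hence
  -- relevant.
  have hB : relBoundaries Δ (irrelevantComplex n) r = ⊥ := by
    have h1 : chains Δ (r + 1) = ⊥ := by
      have : {F | F ∈ Δ ∧ dim F = ((r + 1 : ℕ) : ℤ)} = ∅ := by
        refine Set.eq_empty_of_forall_notMem fun G hG => ?_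
        obtain ⟨F, _, hGF, hFc⟩ := hle G hG.1
        have h2 := Finset.card_le_card hGF
        have h3 := hG.2
        simp only [dim] at h3
        omega
      rw [chains, this, Finsupp.supported_empty]
    have h2 : chains (Δ ⊓ irrelevantComplex n) r = ⊥ := by
      have : {F | F ∈ Δ ⊓ irrelevantComplex n ∧ dim F = (r : ℤ)} = ∅ := by
        refine Set.eq_empty_of_forall_notMem fun G hG => ?_
        obtain ⟨F, hF, hGF, hFc⟩ := hle G hG.1.1
        have h3 := hG.2
        simp only [dim] at h3
        obtain rfl : G = F := Finset.eq_of_subset_of_card_le hGF (by omega)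
        exact (hrel G hF).2 hG.1.2
      rw [chains, this, Finsupp.supported_empty]
    rw [relBoundaries, h1, h2, Submodule.map_bot, sup_bot_eq]
  have htop := Submodule.Quotient.subsingleton_iff.1 hH
  have hmem : (⟨c, hc⟩ : relCycles Δ (irrelevantComplex n) r) ∈
      (relBoundaries Δ (irrelevantComplex n) r).submoduleOf (relCycles Δ (irrelevantComplex n) r) :=
    htop ▸ Submodule.mem_top
  rw [hB] at hmem
  exact (Submodule.mem_bot ℤ).1 hmem

/-- In a sequence of facets, each meeting an earlier one in a relevant simplex, any relevant
`(r - 1)`-simplex is homologous to a given one in the first facet, relative to the irrelevant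
simplices, through the facets up to one that contains it. -/
theorem exists_chain_of_connected (hpure : IsPureOfDim Δ (r : ℤ))
    (hrel : ∀ F, IsFacet Δ F → IsRelevantFace (irrelevantComplex n) Δ F)
    {N : ℕ} {f : ℕ → Finset (CoxVar n)} (hf : ∀ i < N, IsFacet Δ (f i))
    (hinj : Set.InjOn f (Set.Iio N))
    (hpar : ∀ i < N, 0 < i → ∃ j < i, f j ∩ f i ∉ irrelevantComplex n)
    {R₀ : Finset (CoxVar n)} (hR₀ : R₀ ∉ irrelevantComplex n) (hR₀f : R₀ ⊆ f 0)
    (hR₀c : R₀.card = r) (i : ℕ) (hi : i < N) {R : Finset (CoxVar n)}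
    (hR : R ∉ irrelevantComplex n) (hRf : R ⊆ f i) (hRc : R.card = r) :
    ∃ c ∈ Finsupp.supported ℤ ℤ (f '' Set.Iic i),
      boundary c - (Finsupp.single R 1 - Finsupp.single R₀ 1) ∈ irrelevantChains n := by
  induction i using Nat.strong_induction_on generalizing R with
  | _ i ih =>
    have hfi := hf i hi
    have hfic := card_eq_of_isFacet hpure hfi
    have hmem : ∀ m : ℤ, Finsupp.single (f i) m ∈ Finsupp.supported ℤ ℤ (f '' Set.Iic i) :=
      fun m => Finsupp.single_mem_supported ℤ _ ⟨i, Set.mem_Iic.2 le_rfl, rfl⟩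
    rcases Nat.eq_zero_or_pos i with rfl | hpos
    · obtain ⟨m, _, hm⟩ := exists_boundary_smul_single (hrel _ hfi).2 hfic hR hR₀ hRf hR₀f hRc hR₀c
      exact ⟨_, hmem m, hm⟩
    -- Reach the ridge `f j ∩ f i` through facets up to `j`, then cross `f i` from it to `R`.
    · obtain ⟨j, hj, hQ⟩ := hpar i hi hpos
      have hne : f j ≠ f i := fun h => hj.ne (hinj (hj.trans hi) hi h)
      have hQc := card_inter_eq hpure (hf j (hj.trans hi)) hfi hne hQ
      obtain ⟨c, hc, hcb⟩ := ih j hj (hj.trans hi) hQ Finset.inter_subset_left hQc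
      obtain ⟨m, _, hm⟩ := exists_boundary_smul_single (hrel _ hfi).2 hfic hR hQ hRf
        Finset.inter_subset_right hRc hQc
      refine ⟨c + Finsupp.single (f i) m, Submodule.add_mem _ (Finsupp.supported_mono
        (Set.image_mono (Set.Iic_subset_Iic.2 hj.le)) hc) (hmem m), ?_⟩
      convert Submodule.add_mem _ hcb hm using 1
      rw [map_add]
      abel

/-- If the top relative homology vanishes, then in a sequence of facets as above every facet has at
most one relevant intersection with earlier facets. -/
theorem inter_eq_inter_of_connected (hpure : IsPureOfDim Δ (r : ℤ))
    (hrel : ∀ F, IsFacet Δ F → IsRelevantFace (irrelevantComplex n) Δ F)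
    (hH : Subsingleton (RelHomology Δ (irrelevantComplex n) r))
    {N : ℕ} {f : ℕ → Finset (CoxVar n)} (hf : ∀ i < N, IsFacet Δ (f i))
    (hinj : Set.InjOn f (Set.Iio N))
    (hpar : ∀ i < N, 0 < i → ∃ j < i, f j ∩ f i ∉ irrelevantComplex n)
    {i j k : ℕ} (hi : i < N) (hj : j < i) (hk : k < i)
    (hji : f j ∩ f i ∉ irrelevantComplex n) (hki : f k ∩ f i ∉ irrelevantComplex n) :
    f j ∩ f i = f k ∩ f i := by
  by_contra hne
  have hpos : 0 < i := by omega
  have hfne : ∀ l < i, f l ≠ f i := fun l hl h => hl.ne (hinj (hl.trans hi) hi h)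
  have hjc := card_inter_eq hpure (hf j (hj.trans hi)) (hf i hi) (hfne j hj) hji
  have hkc := card_inter_eq hpure (hf k (hk.trans hi)) (hf i hi) (hfne k hk) hki
  -- Any relevant ridge of `f 0` serves as base point; `f 0 ∩ f 1` is one, since the parent of `f 1`
  -- can only be `f 0`.
  obtain ⟨R₀, hR₀, hR₀f, hR₀c⟩ : ∃ R₀ : Finset (CoxVar n), R₀ ∉ irrelevantComplex n ∧ R₀ ⊆ f 0 ∧
      R₀.card = r := by
    have h1 : 1 < N := by omega
    obtain ⟨l, hl, h⟩ := hpar 1 h1 one_pos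
    obtain rfl : l = 0 := by omega
    exact ⟨_, h, Finset.inter_subset_left, card_inter_eq hpure (hf 0 (by omega)) (hf 1 h1)
      (fun h => zero_ne_one (hinj (show 0 < N by omega) h1 h)) h⟩
  obtain ⟨c, hc, hcb⟩ := exists_chain_of_connected hpure hrel hf hinj hpar hR₀ hR₀f hR₀c j
    (hj.trans hi) hji Finset.inter_subset_left hjc
  obtain ⟨d, hd, hdb⟩ := exists_chain_of_connected hpure hrel hf hinj hpar hR₀ hR₀f hR₀c k
    (hk.trans hi) hki Finset.inter_subset_left hkc
  obtain ⟨m, hm, hmb⟩ := exists_boundary_smul_single (hrel _ (hf i hi)).2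
    (card_eq_of_isFacet hpure (hf i hi)) hji hki Finset.inter_subset_right
    Finset.inter_subset_right hjc hkc
  have hnot : ∀ l < i, ∀ e ∈ Finsupp.supported ℤ ℤ (f '' Set.Iic l), e (f i) = 0 := by
    intro l hl e he
    by_contra h
    obtain ⟨t, ht, hti⟩ := he (Finsupp.mem_support_iff.2 h)
    exact hfne t (lt_of_le_of_lt ht hl) hti
  have hchain : ∀ l ≤ i, Finsupp.supported ℤ ℤ (f '' Set.Iic l) ≤ chains Δ r := by
    intro l hl
    refine Finsupp.supported_mono ?_
    rintro _ ⟨t, ht, rfl⟩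
    have hft := hf t (lt_of_le_of_lt (le_trans ht hl) hi)
    exact ⟨hft.1, hpure.2 _ hft⟩
  -- Two different ridges would close a loop: the paths `c` and `d` from the base ridge, joined
  -- across `f i`. Since `c` and `d` avoid `f i`, this relative cycle has the nonzero coefficient
  -- `-m` there.
  have hz : c - d - Finsupp.single (f i) m ∈ chains Δ r := Submodule.sub_mem _
    (Submodule.sub_mem _ (hchain j hj.le hc) (hchain k hk.le hd))
    (hchain i le_rfl (Finsupp.single_mem_supported ℤ _ ⟨i, Set.mem_Iic.2 le_rfl, rfl⟩))
  have hzb : boundary (c - d - Finsupp.single (f i) m) ∈ irrelevantChains n := by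
    convert Submodule.sub_mem _ (Submodule.sub_mem _ hcb hdb) hmb using 1
    rw [map_sub, map_sub]
    abel
  have hzero := eq_zero_of_mem_relCycles hpure hrel hH (c := c - d - Finsupp.single (f i) m)
    ⟨hz, fun G hG => ⟨boundary_mem_supported Δ (Finsupp.supported_mono (fun _ h => h.1) hz) hG,
      hzb hG⟩⟩
  have hval := DFunLike.congr_fun hzero (f i)
  simp only [Finsupp.coe_sub, Pi.sub_apply, hnot j hj c hc, hnot k hk d hd,
    Finsupp.single_eq_same, Finsupp.coe_zero, Pi.zero_apply] at hval
  exact hm hne (by omega)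

/-- In a relevant-connected complex any two relevant facets are joined by a sequence of facets with
relevant consecutive intersections. -/
theorem reflTransGen_isFacet {V : Type*} [Finite V] [DecidableEq V] {B Δ : SimplicialComplex V}
    (hrel : ∀ F, IsFacet Δ F → IsRelevantFace B Δ F) (hconn : RelevantConnected B Δ)
    {F G : Finset V} (hF : IsFacet Δ F) (hG : IsFacet Δ G) :
    Relation.ReflTransGen (fun K L => IsFacet Δ L ∧ K ∩ L ∉ B) F G := by
  -- Every face on the path is replaced by a facet containing it, which only enlarges the
  -- intersections. Quantifying over all facets `L ⊇ K` leaves this choice free at each step.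
  have key : ∀ K, Relation.ReflTransGen
      (fun K L => IsRelevantFace B Δ K ∧ IsRelevantFace B Δ L ∧ IsRelevantFace B Δ (K ∩ L)) F K →
      ∀ L, IsFacet Δ L → K ⊆ L →
        Relation.ReflTransGen (fun K L => IsFacet Δ L ∧ K ∩ L ∉ B) F L := by
    intro K hK
    induction hK with
    | refl =>
      intro L hL hFL
      rw [le_antisymm hFL (hF.2 hL.1 hFL)]
    | @tail K M _ hKM ih =>
      intro L hL hML
      obtain ⟨P, hP, hKP⟩ := exists_isFacet_superset hKM.1.1
      exact (ih P hP hKP).tail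
        ⟨hL, fun h => hKM.2.2.2 (B.lower (Finset.inter_subset_inter hKP hML) h)⟩
  exact key G (hconn F G (hrel F hF) (hrel G hG)) G hG subset_rfl

end Trees

end VirtualShelling

/-! ### The main theorem -/

open VirtualShelling in
theorem corollary5p2 {r : ℕ} (n : Fin r → ℕ)
    (Δ : VirtualShelling.SimplicialComplex (VirtualShelling.CoxVar n))
    (hpure : VirtualShelling.IsPureOfDim Δ (r : ℤ))
    (hrel : ∀ F, VirtualShelling.IsFacet Δ F →
      VirtualShelling.IsRelevantFace (VirtualShelling.irrelevantComplex n) Δ F)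
    (hconn : VirtualShelling.RelevantConnected (VirtualShelling.irrelevantComplex n) Δ)
    (hH : Subsingleton
      (VirtualShelling.RelHomology Δ (VirtualShelling.irrelevantComplex n) r)) :
    VirtualShelling.IsVirtuallyShellable (VirtualShelling.irrelevantComplex n) Δ := by
  have hfin : {F | IsFacet Δ F}.Finite := Set.toFinite _
  set T := hfin.toFinset with hTdef
  have hT : ∀ F, F ∈ T ↔ IsFacet Δ F := fun F => by simp [hTdef]
  obtain ⟨K, hK⟩ := hpure.1
  obtain ⟨F₀, hF₀, _⟩ := exists_isFacet_superset hK
  obtain ⟨f, hinj, hmem, hpar⟩ := exists_connected_enumeration T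
    (fun F G => F ∩ G ∉ irrelevantComplex n) ⟨F₀, (hT _).2 hF₀⟩
    (fun F hF G hG => Relation.ReflTransGen.mono (r := fun K L => IsFacet Δ L ∧ K ∩ L ∉ irrelevantComplex n)
      (fun _ _ h => ⟨(hT _).2 h.1, h.2⟩) _ _
      (reflTransGen_isFacet hrel hconn ((hT _).1 hF) ((hT _).1 hG))) T.card le_rfl
  have hfacet : ∀ i < T.card, IsFacet Δ (f i) := fun i hi => (hT _).1 (hmem i hi)
  have himage : (Finset.range T.card).image f = T := by
    refine Finset.eq_of_subset_of_card_le (fun F hF => ?_) ?_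
    · obtain ⟨i, hi, rfl⟩ := Finset.mem_image.1 hF
      exact hmem i (Finset.mem_range.1 hi)
    · rw [Finset.card_image_of_injOn (by simpa using hinj), Finset.card_range]
  have hord : IsFacetOrdering Δ fun i : Fin T.card => f i := by
    refine ⟨fun i j h => Fin.ext (hinj i.2 j.2 h), ?_⟩
    ext F
    rw [Set.mem_ofPred_eq, ← hT]
    conv_rhs => rw [← himage]
    rw [Finset.mem_image, Set.mem_range]
    exact ⟨fun ⟨i, h⟩ => ⟨i, Finset.mem_range.2 i.2, h⟩,
      fun ⟨i, hi, h⟩ => ⟨⟨i, Finset.mem_range.1 hi⟩, h⟩⟩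
  have hparent : ∀ i : Fin T.card, ∃ q : Fin T.card, (∃ j, j < i) →
      q < i ∧ f q ∩ f i ∉ irrelevantComplex n := by
    intro i
    by_cases h : ∃ j, j < i
    · obtain ⟨j, hj⟩ := h
      obtain ⟨l, hl, hli⟩ := hpar i i.2 (by have : j.val < i.val := hj; omega)
      exact ⟨⟨l, hl.trans i.2⟩, fun _ => ⟨hl, hli⟩⟩
    · exact ⟨i, fun h' => absurd h' h⟩
  choose p hp using hparent
  refine ⟨T.card, fun i => f i, isVirtualShellingOrder_of_parent (p := p) (d := r) hord
    (fun i => card_eq_of_isFacet hpure (hfacet i i.2)) ?_ ?_ ?_⟩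
  · intro L hL
    obtain ⟨G, hG, hLG⟩ := exists_isFacet_superset hL
    obtain ⟨i, rfl⟩ := hord.2.superset hG
    exact ⟨i, hLG⟩
  · intro i hi
    obtain ⟨h1, h2⟩ := hp i hi
    refine ⟨h1, ?_⟩
    rw [Finset.inter_comm]
    exact card_inter_eq hpure (hfacet _ (p i).2) (hfacet i i.2) (fun h => h1.ne (hord.1 h)) h2
  · intro L hL i j hji hLi hLj
    obtain ⟨h1, h2⟩ := hp i ⟨j, hji⟩
    have hLsub : L ⊆ f j ∩ f i := Finset.subset_inter hLj hLi
    have h3 := notMem_irrelevantComplex_of_subset hLsub hL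
    -- A relevant `L` in `f j ∩ f i` makes that intersection relevant, so it equals the intersection
    -- with the parent.
    rw [inter_eq_inter_of_connected hpure hrel hH hfacet hinj hpar i.2 hji h1 h3 h2] at hLsub
    exact hLsub.trans Finset.inter_subset_left
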